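/- Let $\Sigma$ be a set of prime numbers, let $S\subset\mathbb N$ be the multiplicative monoid generated by $\Sigma$, and let $$\mathbb A_{\mathbb Z[S^{-1}],f}=\prod_{q\in\Sigma}{}^{'}(\mathbb Q_q,\mathbb Z_q)$$ be the ring of finite adeles associated to $S$, i.e. the restricted product of the topological fields $\mathbb Q_q$ ($q\in\Sigma$) with respect to the compact open subrings $\mathbb Z_q$. Let $Q$ be a locally compact Hausdorff topological module over $\mathbb A_{\mathbb Z[S^{-1}],f}$ (so $Q$ is a locally compact Hausdorff abelian group and the scalar multiplication is jointly continuous). Then there are locally compact Hausdorff topological $\mathbb Q_q$-vector spaces $Q_q$ and integers $n_q\ge 0$ ($q\in\Sigma$) such that the following hold. 1. $Q_q\cong\mathbb Q_q^{n_q}$ as a topological $\mathbb Q_q$-vector space, for each $q\in\Sigma$; and each $Q_q$ has a compact open subgroup. 2. For every choice of compact open subgroups $Z_q\subset Q_q$ ($q\in\Sigma$), $$Q\;\cong\;\prod_{q\in\Sigma}{}^{'}(Q_q,Z_q)$$ as topological $\mathbb A_{\mathbb Z[S^{-1}],f}$-modules, where the restricted product carries the coordinatewise action $(a_q)_q\cdot(v_q)_q=(a_qv_q)_q$.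 (In particular this is an isomorphism of topological $\mathbb Z[S^{-1}]$-modules.) 3. $Q\cong\prod'_{q\in\Sigma}(\mathbb Q_q^{n_q},\mathbb Z_q^{n_q})$, again as topological $\mathbb A_{\mathbb Z[S^{-1}],f}$-modules with the coordinatewise action. -/

import Mathlib

open scoped RestrictedProduct

universe u

instance Nat.Primes.factPrime (q : Nat.Primes) : Fact (Nat.Prime (q : ℕ)) := ⟨q.2⟩

/-- The ring of finite adeles attached to a set `P` of prime numbers: the restricted product
of the fields `ℚ_q` relative to the open subrings `ℤ_q`, for `q ∈ P`. Its ring operations are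
coordinatewise and its topology is the restricted product topology. -/
abbrev FiniteAdeles (P : Set Nat.Primes) : Type :=
  Πʳ q : P, [ℚ_[(q : Nat.Primes)], PadicInt.subring (q : Nat.Primes)]

/-- The subgroup `ℤ_p ^ n` of `ℚ_p ^ n`. -/
noncomputable def padicLattice (p : ℕ) [Fact p.Prime] (n : ℕ) : AddSubgroup (Fin n → ℚ_[p]) :=
  AddSubgroup.pi Set.univ fun _ => (PadicInt.subring p).toAddSubgroup

/-- The topological module `Q` over the finite adeles is isomorphic to the restricted product
of the `ℚ_q`-vector spaces `V q` relative to the subgroups `Z q`: there is an isomorphism of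
topological groups which carries the scalar multiplication of `Q` to the coordinatewise one,
`(a • v) q = a q • v q`. -/
def IsIsomorphicToRestrictedProduct {P : Set Nat.Primes}
    (Q : Type*) [AddCommGroup Q] [TopologicalSpace Q] [Module (FiniteAdeles P) Q]
    (V : P → Type*) [∀ q, AddCommGroup (V q)] [∀ q, TopologicalSpace (V q)]
    [∀ q : P, Module ℚ_[(q : Nat.Primes)] (V q)] (Z : ∀ q, AddSubgroup (V q)) : Prop :=
  ∃ f : Q ≃ₜ+ Πʳ q, [V q, Z q],
    ∀ (a : FiniteAdeles P) (x : Q) (q : P), f (a • x) q = a q • f x q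

/-! The idempotent of the adele ring supported at `q` cuts out of `Q` a closed piece, `component Q
q`. It is a locally compact `ℚ_q`-vector space, hence finite-dimensional. To glue the pieces,
`exists_addSubgroup_indicator_smul_mem` builds a compact open subgroup `W` stable under all
idempotents. Relative to the traces of `W`, taking components is injective because each vector is
the limit of its finite partial sums, and surjective because partial sums cluster in a translate of
`W`. It is a homeomorphism because it restricts to a continuous bijection from `W` onto the product
of its traces. The choice of compact open subgroups does not matter: each is a lattice over the PID
`ℤ_q`, hence free of full rank, so a linear isomorphism carries it to `ℤ_q ^ n`. -/

open Filter Topology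

/-! ### Compact open subgroups of `ℚ_p ^ n` as lattices -/

/-- The `ℤ_p`-submodule of `ℚ_p ^ n` underlying a closed subgroup. -/
def AddSubgroup.toPadicIntSubmodule {p n : ℕ} [Fact p.Prime] (Z : AddSubgroup (Fin n → ℚ_[p]))
    (hZ : IsClosed (Z : Set (Fin n → ℚ_[p]))) : Submodule ℤ_[p] (Fin n → ℚ_[p]) where
  carrier := Z
  add_mem' := Z.add_mem
  zero_mem' := Z.zero_mem
  smul_mem' c v hv := by
    have hcont : Continuous fun c : ℤ_[p] => ((c : ℤ_[p]) : ℚ_[p]) • v :=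
      (continuous_subtype_val (p := fun x : ℚ_[p] => ‖x‖ ≤ 1)).smul continuous_const
    -- `ℤ` is dense in `ℤ_p`, so closedness upgrades integer multiples to `ℤ_p`-multiples.
    refine PadicInt.denseRange_intCast.induction_on
      (p := fun c : ℤ_[p] => ((c : ℤ_[p]) : ℚ_[p]) • v ∈ (Z : Set (Fin n → ℚ_[p]))) c
      (hZ.preimage hcont) fun k => ?_
    rw [PadicInt.coe_intCast, Int.cast_smul_eq_zsmul]
    exact Z.zsmul_mem hv k

theorem tendsto_padic_pow_smul {p n : ℕ} [Fact p.Prime] (v : Fin n → ℚ_[p]) :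
    Tendsto (fun k : ℕ => (p : ℚ_[p]) ^ k • v) atTop (𝓝 0) := by
  have h : Tendsto (fun k : ℕ => (p : ℚ_[p]) ^ k) atTop (𝓝 0) :=
    tendsto_pow_atTop_nhds_zero_of_norm_lt_one Padic.norm_p_lt_one
  simpa using h.smul_const v

theorem mem_padicLattice {p n : ℕ} [Fact p.Prime] {v : Fin n → ℚ_[p]} :
    v ∈ padicLattice p n ↔ ∀ i, ‖v i‖ ≤ 1 := by
  simp [padicLattice, AddSubgroup.mem_pi, PadicInt.mem_subring_iff]

theorem isCompact_padicInt_subring (p : ℕ) [Fact p.Prime] :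
    IsCompact (PadicInt.subring p : Set ℚ_[p]) := by
  have : CompactSpace (PadicInt.subring p) := PadicInt.compactSpace (p := p)
  exact isCompact_iff_compactSpace.mpr this

theorem isOpen_padicInt_subring (p : ℕ) [Fact p.Prime] :
    IsOpen (PadicInt.subring p : Set ℚ_[p]) := by
  convert! IsUltrametricDist.isOpen_closedBall (0 : ℚ_[p]) one_ne_zero using 1
  ext x
  simp [PadicInt.mem_subring_iff]

theorem coe_padicLattice (p n : ℕ) [Fact p.Prime] :
    (padicLattice p n : Set (Fin n → ℚ_[p])) = Set.univ.pi fun _ => PadicInt.subring p := rfl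

theorem isCompact_padicLattice (p n : ℕ) [Fact p.Prime] :
    IsCompact (padicLattice p n : Set (Fin n → ℚ_[p])) := by
  rw [coe_padicLattice]
  exact isCompact_univ_pi fun _ => isCompact_padicInt_subring p

theorem isOpen_padicLattice (p n : ℕ) [Fact p.Prime] :
    IsOpen (padicLattice p n : Set (Fin n → ℚ_[p])) := by
  rw [coe_padicLattice]
  exact isOpen_set_pi Set.finite_univ fun _ _ => isOpen_padicInt_subring p

/-- A compact open subgroup of `ℚ_p ^ n` is a `ℤ_p`-lattice. -/
theorem isLattice_toPadicIntSubmodule {p n : ℕ} [Fact p.Prime] (Z : AddSubgroup (Fin n → ℚ_[p]))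
    (hc : IsCompact (Z : Set (Fin n → ℚ_[p]))) (ho : IsOpen (Z : Set (Fin n → ℚ_[p]))) :
    Submodule.IsLattice ℚ_[p] (Z.toPadicIntSubmodule hc.isClosed) := by
  have hp : (p : ℚ_[p]) ≠ 0 := by exact_mod_cast (Fact.out : p.Prime).ne_zero
  constructor
  -- Boundedness lets a power of `p` scale the subgroup into `ℤ_p ^ n`, a Noetherian module.
  · obtain ⟨C, hC⟩ := hc.isBounded.exists_norm_le
    have hlim : Tendsto (fun k : ℕ => ‖(p : ℚ_[p]) ^ k‖ * C) atTop (𝓝 0) := by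
      simpa using (tendsto_pow_atTop_nhds_zero_of_norm_lt_one
        (Padic.norm_p_lt_one (p := p))).norm.mul_const C
    obtain ⟨k, hk⟩ := (hlim.eventually (ge_mem_nhds one_pos)).exists
    let φ : Z.toPadicIntSubmodule hc.isClosed →ₗ[ℤ_[p]] (Fin n → ℤ_[p]) :=
      { toFun := fun v i => ⟨(p : ℚ_[p]) ^ k * v.1 i, by
          rw [norm_mul]
          refine le_trans ?_ hk
          gcongr
          exact (norm_le_pi_norm _ i).trans (hC _ v.2)⟩
        map_add' := fun v w => by
          ext i
          exact mul_add _ _ _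
        map_smul' := fun c v => by
          ext i
          exact mul_left_comm _ _ _ }
    have hφ : Function.Injective φ := by
      intro v w h
      ext i
      have := congrArg Subtype.val (congrFun h i)
      exact mul_left_cancel₀ (pow_ne_zero k hp) this
    have := Module.Finite.of_injective φ hφ
    exact Module.Finite.iff_fg.mp this
  · rw [eq_top_iff]
    intro v _
    obtain ⟨k, hk⟩ := ((tendsto_padic_pow_smul v).eventually (ho.mem_nhds Z.zero_mem)).exists
    have : v = ((p : ℚ_[p]) ^ k)⁻¹ • ((p : ℚ_[p]) ^ k • v) := by
      rw [inv_smul_smul₀ (pow_ne_zero k hp)]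
    rw [this]
    exact Submodule.smul_mem _ _ (Submodule.subset_span hk)

/-- Every compact open subgroup of `ℚ_p ^ n` is carried to `ℤ_p ^ n` by a linear automorphism. -/
theorem exists_equiv_mem_padicLattice_iff {p n : ℕ} [Fact p.Prime]
    (Z : AddSubgroup (Fin n → ℚ_[p]))
    (hc : IsCompact (Z : Set (Fin n → ℚ_[p]))) (ho : IsOpen (Z : Set (Fin n → ℚ_[p]))) :
    ∃ g : (Fin n → ℚ_[p]) ≃L[ℚ_[p]] (Fin n → ℚ_[p]), ∀ v, g v ∈ padicLattice p n ↔ v ∈ Z := by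
  have := isLattice_toPadicIntSubmodule Z hc ho
  set M := Z.toPadicIntSubmodule hc.isClosed
  have hr : Module.finrank ℤ_[p] M = n := by
    simpa using Submodule.IsLattice.finrank_of_pi (K := ℚ_[p]) M
  let b : Module.Basis (Fin n) ℤ_[p] M := Module.finBasisOfFinrankEq ℤ_[p] M hr
  let B := b.extendOfIsLattice ℚ_[p]
  refine ⟨B.equivFun.toContinuousLinearEquiv, fun v => ?_⟩
  rw [mem_padicLattice]
  change (∀ i, ‖B.equivFun v i‖ ≤ 1) ↔ v ∈ M
  constructor
  · intro h
    rw [← B.sum_equivFun v]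
    refine Submodule.sum_mem _ fun i _ => ?_
    rw [Module.Basis.extendOfIsLattice_apply]
    exact M.smul_mem (⟨_, h i⟩ : ℤ_[p]) (b i).2
  · intro h i
    have hv : v = ∑ i, ((b.equivFun ⟨v, h⟩ i : ℤ_[p]) : ℚ_[p]) • B i := by
      have := congrArg Subtype.val (b.sum_equivFun ⟨v, h⟩)
      simp only [Submodule.coe_sum, Submodule.coe_smul] at this
      refine this.symm.trans (Finset.sum_congr rfl fun i _ => ?_)
      rw [Module.Basis.extendOfIsLattice_apply]
      rfl
    have : B.equivFun v = fun i => ((b.equivFun ⟨v, h⟩ i : ℤ_[p]) : ℚ_[p]) := by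
      conv_lhs => rw [hv, ← B.equivFun_symm_apply]
      exact B.equivFun.apply_symm_apply _
    rw [this]
    exact PadicInt.norm_le_one _

section

variable {p n : ℕ} [Fact p.Prime] {V : Type*} [AddCommGroup V] [TopologicalSpace V]
  [Module ℚ_[p] V]

theorem exists_isCompact_isOpen_addSubgroup (g : V ≃L[ℚ_[p]] (Fin n → ℚ_[p])) :
    ∃ Z : AddSubgroup V, IsCompact (Z : Set V) ∧ IsOpen (Z : Set V) :=
  ⟨(padicLattice p n).comap (g : V →+ (Fin n → ℚ_[p])),
    g.toHomeomorph.isClosedEmbedding.isCompact_preimage (isCompact_padicLattice p n),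
    (isOpen_padicLattice p n).preimage g.continuous⟩

/-- Every compact open subgroup of a space isomorphic to `ℚ_p ^ n` is carried to `ℤ_p ^ n` by some
linear isomorphism. -/
theorem exists_equiv_pi_mem_padicLattice_iff (g : V ≃L[ℚ_[p]] (Fin n → ℚ_[p]))
    (Z : AddSubgroup V) (hc : IsCompact (Z : Set V)) (ho : IsOpen (Z : Set V)) :
    ∃ h : V ≃L[ℚ_[p]] (Fin n → ℚ_[p]), ∀ v, h v ∈ padicLattice p n ↔ v ∈ Z := by
  obtain ⟨h, hh⟩ := exists_equiv_mem_padicLattice_iff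
    (Z.comap (g.symm : (Fin n → ℚ_[p]) →+ V))
    (g.symm.toHomeomorph.isClosedEmbedding.isCompact_preimage hc)
    (ho.preimage g.symm.continuous)
  refine ⟨g.trans h, fun v => (hh _).trans ?_⟩
  change g.symm (g v) ∈ Z ↔ v ∈ Z
  rw [ContinuousLinearEquiv.symm_apply_apply]

end

/-! ### Maps and convergence in restricted products -/

/-- Topological isomorphisms of the factors which match up the distinguished subgroups induce
a topological isomorphism of restricted products. -/
def RestrictedProduct.continuousAddEquivCongr {ι : Type*} {V V' : ι → Type*}
    [∀ i, AddCommGroup (V i)] [∀ i, TopologicalSpace (V i)]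
    [∀ i, AddCommGroup (V' i)] [∀ i, TopologicalSpace (V' i)]
    {Z : ∀ i, AddSubgroup (V i)} {Z' : ∀ i, AddSubgroup (V' i)}
    (g : ∀ i, V i ≃ₜ+ V' i) (hg : ∀ i v, g i v ∈ Z' i ↔ v ∈ Z i) :
    (Πʳ i, [V i, Z i]) ≃ₜ+ Πʳ i, [V' i, Z' i] where
  toFun := RestrictedProduct.map (fun i => g i) (.of_forall fun i v hv => (hg i v).mpr hv)
  invFun := RestrictedProduct.map (fun i => (g i).symm)
    (.of_forall fun i v hv => (hg i _).mp (by simpa using hv))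
  left_inv x := by ext i; simp
  right_inv x := by ext i; simp
  map_add' x y := by ext i; simp
  continuous_toFun := RestrictedProduct.mapAlong_continuous _ _ id tendsto_id (fun i => g i)
    (.of_forall fun i v hv => (hg i v).mpr hv) fun i => (g i).continuous
  continuous_invFun := RestrictedProduct.mapAlong_continuous _ _ id tendsto_id
    (fun i => (g i).symm) (.of_forall fun i v hv => (hg i _).mp (by simpa using hv))
    fun i => (g i).symm.continuous

/-- Among the points of a restricted product with all coordinates in the distinguished subsets,
convergence is coordinatewise. -/
theorem RestrictedProduct.tendsto_of_forall_mem {ι α : Type*} {R : ι → Type*}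
    [∀ i, TopologicalSpace (R i)] {A : ∀ i, Set (R i)} {l : Filter α} {a : α → Πʳ i, [R i, A i]}
    {b : Πʳ i, [R i, A i]} (ha : ∀ x i, a x i ∈ A i) (hb : ∀ i, b i ∈ A i)
    (h : ∀ i, Tendsto (fun x => a x i) l (𝓝 (b i))) : Tendsto a l (𝓝 b) := by
  have h' : Tendsto (fun x i => (⟨a x i, ha x i⟩ : A i)) l (𝓝 fun i => ⟨b i, hb i⟩) :=
    tendsto_pi_nhds.mpr fun i => tendsto_subtype_rng.mpr (h i)
  exact (isEmbedding_structureMap.continuous.tendsto _).comp h'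

theorem IsIsomorphicToRestrictedProduct.congr {P : Set Nat.Primes}
    {Q : Type*} [AddCommGroup Q] [TopologicalSpace Q] [Module (FiniteAdeles P) Q]
    {V V' : P → Type*} [∀ q, AddCommGroup (V q)] [∀ q, TopologicalSpace (V q)]
    [∀ q : P, Module ℚ_[(q : Nat.Primes)] (V q)]
    [∀ q, AddCommGroup (V' q)] [∀ q, TopologicalSpace (V' q)]
    [∀ q : P, Module ℚ_[(q : Nat.Primes)] (V' q)]
    {Z : ∀ q, AddSubgroup (V q)} {Z' : ∀ q, AddSubgroup (V' q)}
    (h : IsIsomorphicToRestrictedProduct Q V Z)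
    (g : ∀ q : P, V q ≃L[ℚ_[(q : Nat.Primes)]] V' q) (hg : ∀ q v, g q v ∈ Z' q ↔ v ∈ Z q) :
    IsIsomorphicToRestrictedProduct Q V' Z' := by
  obtain ⟨f, hf⟩ := h
  refine ⟨f.trans (RestrictedProduct.continuousAddEquivCongr
    (fun q => (g q).toContinuousAddEquiv) hg), fun a x q => ?_⟩
  exact (congrArg (g q) (hf a x q)).trans (map_smul (g q) _ _)

/-! ### Idempotent adeles -/

namespace FiniteAdeles

variable {P : Set Nat.Primes}

open Classical in
/-- The adele with component `1` at the primes in `S` and `0` elsewhere. -/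
noncomputable def indicator (S : Set P) : FiniteAdeles P :=
  ⟨fun q => if q ∈ S then 1 else 0, .of_forall fun q => by
    beta_reduce
    split_ifs
    exacts [one_mem (PadicInt.subring _), zero_mem (PadicInt.subring _)]⟩

open Classical in
theorem indicator_apply (S : Set P) (q : P) : indicator S q = if q ∈ S then 1 else 0 := rfl

theorem indicator_mul (S T : Set P) : indicator S * indicator T = indicator (S ∩ T) := by
  classical
  ext q
  simp only [RestrictedProduct.mul_apply, indicator_apply, Set.mem_inter_iff]
  split_ifs <;> simp_all

@[simp] theorem indicator_univ : indicator (Set.univ : Set P) = 1 := by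
  ext q
  simp [indicator_apply]

@[simp] theorem indicator_empty : indicator (∅ : Set P) = 0 := by
  ext q
  simp [indicator_apply]

theorem indicator_union {S T : Set P} (h : Disjoint S T) :
    indicator (S ∪ T) = indicator S + indicator T := by
  classical
  ext q
  have hq : q ∈ S → q ∉ T := fun hS => Set.disjoint_left.mp h hS
  simp only [RestrictedProduct.add_apply, indicator_apply, Set.mem_union]
  by_cases hS : q ∈ S <;> simp_all

theorem indicator_finset (F : Finset P) : indicator (F : Set P) = ∑ q ∈ F, indicator {q} := by
  classical
  induction F using Finset.induction_on with
  | empty => simp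
  | insert q F hq ih =>
    rw [Finset.sum_insert hq, Finset.coe_insert, Set.insert_eq, indicator_union (by simpa using hq),
      ih]

/-- The set of integral adeles is compact. -/
theorem isCompact_integral : IsCompact {a : FiniteAdeles P | ∀ q, a q ∈ PadicInt.subring q.1} := by
  have (q : P) : CompactSpace (PadicInt.subring (q.1 : ℕ)) :=
    isCompact_iff_compactSpace.mp (isCompact_padicInt_subring _)
  have h := isCompact_range (RestrictedProduct.isEmbedding_structureMap
    (R := fun q : P => ℚ_[(q : Nat.Primes)])
    (A := fun q => (PadicInt.subring (q : Nat.Primes) : Set ℚ_[(q : Nat.Primes)]))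
    (𝓕 := cofinite)).continuous
  rwa [RestrictedProduct.range_structureMap] at h

theorem indicator_mem (S : Set P) (q : P) : indicator S q ∈ PadicInt.subring q.1 := by
  rw [indicator_apply]
  split_ifs
  exacts [one_mem _, zero_mem _]

theorem tendsto_indicator_compl :
    Tendsto (fun F : Finset P => indicator ((F : Set P)ᶜ)) atTop (𝓝 0) := by
  refine RestrictedProduct.tendsto_of_forall_mem (fun F => indicator_mem _)
    (fun q => zero_mem (PadicInt.subring q.1)) fun q => ?_
  refine tendsto_const_nhds.congr' ?_
  filter_upwards [eventually_ge_atTop {q}] with F hF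
  simp [indicator_apply, Finset.singleton_subset_iff.mp hF]

theorem tendsto_indicator_singleton :
    Tendsto (fun q : P => indicator {q}) cofinite (𝓝 0) := by
  refine RestrictedProduct.tendsto_of_forall_mem (fun F => indicator_mem _)
    (fun q => zero_mem (PadicInt.subring q.1)) fun q => ?_
  refine tendsto_const_nhds.congr' ?_
  filter_upwards [(Set.finite_singleton q).compl_mem_cofinite] with r hr
  simp [indicator_apply, Ne.symm (show r ≠ q from hr)]

open Classical in
/-- The adele with component `a` at `q` and `0` elsewhere. -/
noncomputable def single (q : P) (a : ℚ_[(q : Nat.Primes)]) : FiniteAdeles P :=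
  RestrictedProduct.single (fun q : P => PadicInt.subring (q : Nat.Primes)) q a

@[simp] theorem single_same (q : P) (a : ℚ_[(q : Nat.Primes)]) : single q a q = a :=
  RestrictedProduct.single_eq_same ..

theorem single_of_ne {q r : P} (h : r ≠ q) (a : ℚ_[(q : Nat.Primes)]) : single q a r = 0 :=
  RestrictedProduct.single_eq_of_ne _ _ h

theorem ext_single {q : P} {a : ℚ_[(q : Nat.Primes)]} {b : FiniteAdeles P} (h : a = b q)
    (h' : ∀ r, r ≠ q → b r = 0) : single q a = b := by
  ext r
  by_cases hr : r = q
  · subst hr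
    simp [h]
  · rw [single_of_ne hr, h' r hr]

theorem single_one (q : P) : single q 1 = indicator {q} :=
  ext_single (by simp [indicator_apply]) fun r hr => by simp [indicator_apply, hr]

theorem single_add (q : P) (a b : ℚ_[(q : Nat.Primes)]) :
    single q (a + b) = single q a + single q b :=
  ext_single (by simp) fun r hr => by simp [single_of_ne hr]

theorem single_mul (q : P) (a b : ℚ_[(q : Nat.Primes)]) :
    single q (a * b) = single q a * single q b :=
  ext_single (by simp) fun r hr => by simp [single_of_ne hr]

theorem single_zero (q : P) : single q 0 = 0 := ext_single (by simp) fun r hr => by simp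

theorem mul_indicator_singleton (a : FiniteAdeles P) (q : P) :
    a * indicator {q} = single q (a q) :=
  (ext_single (by simp [indicator_apply]) fun r hr => by simp [indicator_apply, hr]).symm

/-- The map factors through the stage where all coordinates away from `q` are integral; there
continuity is coordinatewise. -/
theorem continuous_single (q : P) : Continuous (single q) := by
  classical
  have hS : cofinite ≤ 𝓟 ({q}ᶜ : Set P) := by simp
  let φ : ℚ_[(q : Nat.Primes)] → Πʳ r : P, [ℚ_[(r : Nat.Primes)],
      (PadicInt.subring (r : Nat.Primes) : Set ℚ_[(r : Nat.Primes)])]_[𝓟 ({q}ᶜ : Set P)] := fun a =>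
    ⟨single q a, fun r hr => by
      change single q a r ∈ PadicInt.subring (r : Nat.Primes)
      rw [single_of_ne hr]
      exact zero_mem _⟩
  have hφ : Continuous φ := by
    rw [RestrictedProduct.continuous_rng_of_principal_iff_forall]
    intro r
    change Continuous fun a => single q a r
    by_cases hr : r = q
    · subst hr
      simpa using! continuous_id
    · simpa [single_of_ne hr] using continuous_const
  exact (RestrictedProduct.continuous_inclusion hS).comp hφ

/-! ### Components of a module over the adeles -/

section component

variable (Q : Type*) [AddCommGroup Q] [Module (FiniteAdeles P) Q]

/-- The `q`-component of a module over the finite adeles. -/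
def component (q : P) : AddSubgroup Q where
  carrier := {x | indicator {q} • x = x}
  add_mem' {x y} hx hy := by
    change indicator {q} • (x + y) = x + y
    rw [smul_add, hx, hy]
  zero_mem' := smul_zero _
  neg_mem' {x} hx := by
    change indicator {q} • (-x) = -x
    rw [smul_neg, hx]

variable {Q}

theorem mem_component {q : P} {x : Q} : x ∈ component Q q ↔ indicator {q} • x = x := Iff.rfl

theorem single_smul_mem_component (q : P) (a : ℚ_[(q : Nat.Primes)]) (x : Q) :
    single q a • x ∈ component Q q := by
  rw [mem_component, smul_smul, mul_comm, mul_indicator_singleton, single_same]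

noncomputable instance (q : P) : Module ℚ_[(q : Nat.Primes)] (component Q q) where
  smul a v := ⟨single q a • (v : Q), single_smul_mem_component q a (v : Q)⟩
  one_smul v := Subtype.ext <| by
    change single q 1 • (v : Q) = v
    rw [single_one]
    exact v.2
  mul_smul a b v := Subtype.ext <| by
    change single q (a * b) • (v : Q) = single q a • single q b • (v : Q)
    rw [single_mul, mul_smul]
  smul_zero a := Subtype.ext <| smul_zero (single q a)
  smul_add a v w := Subtype.ext <| smul_add (single q a) (v : Q) (w : Q)
  add_smul a b v := Subtype.ext <| by
    change single q (a + b) • (v : Q) = single q a • (v : Q) + single q b • (v : Q)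
    rw [single_add, add_smul]
  zero_smul v := Subtype.ext <| by
    change single q 0 • (v : Q) = 0
    rw [single_zero, zero_smul]

theorem coe_component_smul (q : P) (a : ℚ_[(q : Nat.Primes)]) (v : component Q q) :
    ((a • v : component Q q) : Q) = single q a • (v : Q) := rfl

variable (Q) in
/-- The projection of a module over the finite adeles onto its `q`-component. -/
noncomputable def proj (q : P) : Q →+ component Q q where
  toFun x := ⟨indicator {q} • x, by rw [← single_one]; exact single_smul_mem_component q 1 x⟩
  map_zero' := Subtype.ext <| smul_zero (indicator {q})
  map_add' x y := Subtype.ext <| smul_add (indicator {q}) x y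

@[simp] theorem coe_proj (q : P) (x : Q) : (proj Q q x : Q) = indicator {q} • x := rfl

theorem proj_smul (q : P) (a : FiniteAdeles P) (x : Q) : proj Q q (a • x) = a q • proj Q q x := by
  ext
  rw [coe_proj, coe_component_smul, coe_proj, ← mul_indicator_singleton, mul_smul, smul_smul,
    smul_smul, smul_smul, mul_assoc, indicator_mul, Set.inter_self, mul_comm]

theorem proj_coe (q : P) (v : component Q q) : proj Q q (v : Q) = v := Subtype.ext v.2

theorem proj_indicator_smul_of_mem {q : P} {S : Set P} (h : q ∈ S) (x : Q) :
    proj Q q (indicator S • x) = proj Q q x := by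
  rw [proj_smul, indicator_apply, if_pos h, one_smul]

theorem proj_indicator_smul_of_notMem {q : P} {S : Set P} (h : q ∉ S) (x : Q) :
    proj Q q (indicator S • x) = 0 := by
  rw [proj_smul, indicator_apply, if_neg h, zero_smul]

theorem proj_coe_of_ne {q r : P} (h : r ≠ q) (v : component Q q) : proj Q r (v : Q) = 0 := by
  have hv : indicator {q} • (v : Q) = v := v.2
  have h' := proj_indicator_smul_of_notMem (S := {q}) (by simpa using h) (v : Q)
  rwa [hv] at h'

theorem sum_proj (F : Finset P) (x : Q) :
    ∑ q ∈ F, (proj Q q x : Q) = indicator (F : Set P) • x := by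
  simp_rw [coe_proj]
  rw [← Finset.sum_smul, ← indicator_finset]

end component

/-! ### Topology of the components and the compact open subgroup -/

variable {Q : Type*} [AddCommGroup Q] [Module (FiniteAdeles P) Q] [TopologicalSpace Q]

section

variable [ContinuousSMul (FiniteAdeles P) Q]

theorem continuous_proj (q : P) : Continuous (proj Q q) :=
  (continuous_const_smul (indicator {q})).subtype_mk _

instance (q : P) : ContinuousSMul ℚ_[(q : Nat.Primes)] (component Q q) where
  continuous_smul := Continuous.subtype_mk
    (((continuous_single q).comp continuous_fst).smul
      (continuous_subtype_val.comp continuous_snd)) _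

/-- Joint continuity at each `(0, x)`, made uniform in `x` by compactness of `K`. -/
theorem eventually_smul_mem {K U : Set Q} (hK : IsCompact K) (hU : U ∈ 𝓝 0) :
    ∀ᶠ a : FiniteAdeles P in 𝓝 0, ∀ x ∈ K, a • x ∈ U := by
  refine hK.eventually_forall_of_forall_eventually fun x _ => ?_
  have h : Tendsto (fun z : FiniteAdeles P × Q => z.1 • z.2) (𝓝 (0, x)) (𝓝 0) := by
    simpa using (continuous_smul (M := FiniteAdeles P) (X := Q)).tendsto (0, x)
  exact h hU

/-- Compact neighbourhoods of zero can be chosen stable under the integral adeles. -/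
theorem exists_isCompact_smul_mem [LocallyCompactSpace Q] :
    ∃ K : Set Q, IsCompact K ∧ K ∈ 𝓝 0 ∧
      ∀ a : FiniteAdeles P, (∀ q, a q ∈ PadicInt.subring q.1) → ∀ x ∈ K, a • x ∈ K := by
  obtain ⟨K, hK, hK0⟩ := exists_compact_mem_nhds (0 : Q)
  refine ⟨(fun z : FiniteAdeles P × Q => z.1 • z.2) ''
    ({a : FiniteAdeles P | ∀ q, a q ∈ PadicInt.subring q.1} ×ˢ K),
    (isCompact_integral.prod hK).image continuous_smul, mem_of_superset hK0 fun x hx =>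
      ⟨(1, x), ⟨fun q => one_mem (PadicInt.subring q.1), hx⟩, one_smul _ x⟩, ?_⟩
  rintro a ha _ ⟨⟨b, x⟩, ⟨hb, hx⟩, rfl⟩
  exact ⟨(a * b, x), ⟨fun q => mul_mem (ha q) (hb q), hx⟩, mul_smul _ _ _⟩

/-- Every vector is the sum of its components. -/
theorem tendsto_indicator_smul [IsTopologicalAddGroup Q] (x : Q) :
    Tendsto (fun F : Finset P => indicator (F : Set P) • x) atTop (𝓝 x) := by
  have h : Tendsto (fun F : Finset P => x - indicator ((F : Set P)ᶜ) • x) atTop (𝓝 x) := by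
    simpa using tendsto_const_nhds.sub ((tendsto_indicator_compl (P := P)).smul_const x)
  refine h.congr fun F => ?_
  rw [sub_eq_iff_eq_add, ← add_smul, ← indicator_union disjoint_compl_right, Set.union_compl_self,
    indicator_univ, one_smul]

theorem isClosed_component [T2Space Q] (q : P) : IsClosed (component Q q : Set Q) :=
  isClosed_eq (continuous_const_smul (indicator {q})) continuous_id

instance [T2Space Q] [LocallyCompactSpace Q] (q : P) : LocallyCompactSpace (component Q q) :=
  (isClosed_component q).isClosedEmbedding_subtypeVal.locallyCompactSpace

theorem exists_component_equiv [IsTopologicalAddGroup Q] [T2Space Q] [LocallyCompactSpace Q]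
    (q : P) : ∃ n : ℕ, Nonempty (component Q q ≃L[ℚ_[(q : Nat.Primes)]]
      (Fin n → ℚ_[(q : Nat.Primes)])) := by
  have : FiniteDimensional ℚ_[(q : Nat.Primes)] (component Q q) :=
    FiniteDimensional.of_locallyCompactSpace ℚ_[(q : Nat.Primes)]
  exact ⟨_, ⟨(Module.finBasis ℚ_[(q : Nat.Primes)]
    (component Q q)).equivFun.toContinuousLinearEquiv⟩⟩

/-- A compact open subgroup stable under the idempotent adeles. -/
theorem exists_addSubgroup_indicator_smul_mem [IsTopologicalAddGroup Q] [T2Space Q]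
    [LocallyCompactSpace Q] (Z : ∀ q : P, AddSubgroup (component Q q))
    (hZ : ∀ q, IsCompact (Z q : Set (component Q q)))
    (hZo : ∀ q, IsOpen (Z q : Set (component Q q))) :
    ∃ W : AddSubgroup Q, IsCompact (W : Set Q) ∧ IsOpen (W : Set Q) ∧
      ∀ S : Set P, ∀ x ∈ W, indicator S • x ∈ W := by
  obtain ⟨K, hK, hK0, hKs⟩ := exists_isCompact_smul_mem (P := P) (Q := Q)
  obtain ⟨U, hU, hUK⟩ := exists_nhds_zero_half hK0
  -- The complementary idempotents tend to `0`, so one of them shrinks `K` into `U`, where `U + U ⊆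
  -- K`.
  obtain ⟨F, hF⟩ := ((tendsto_indicator_compl (P := P)).eventually (eventually_smul_mem hK hU)).exists
  set e : FiniteAdeles P := indicator ((F : Set P)ᶜ) with he
  have hee (x : Q) : e • e • x = e • x := by
    rw [smul_smul, he, indicator_mul, Set.inter_self]
  let W : AddSubgroup Q :=
    { carrier := {x | e • x ∈ K ∧ ∀ q ∈ F, proj Q q x ∈ Z q}
      zero_mem' := ⟨by simpa using mem_of_mem_nhds hK0, fun q _ => by simp⟩
      -- Since `e` is idempotent, `e • x` in `K` already lies in `U`, so the sum stays in `K`.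
      add_mem' := fun {x y} hx hy => ⟨by
        rw [smul_add, ← hee x, ← hee y]
        exact hUK _ (hF _ hx.1) _ (hF _ hy.1), fun q hq => by
        rw [map_add]
        exact add_mem (hx.2 q hq) (hy.2 q hq)⟩
      neg_mem' := fun {x} hx => ⟨by
        have := hKs (-1) (fun q => neg_mem (one_mem _)) _ hx.1
        rwa [neg_smul, one_smul, ← smul_neg] at this, fun q hq => by
        rw [map_neg]
        exact neg_mem (hx.2 q hq)⟩ }
  have hW : (W : Set Q) = (e • ·) ⁻¹' K ∩ ⋂ q ∈ F, proj Q q ⁻¹' (Z q : Set _) := by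
    ext x
    simp [W, ← SetLike.mem_coe]
  refine ⟨W, ?_, ?_, ?_⟩
  · have hcl : IsClosed (W : Set Q) := by
      rw [hW]
      exact (hK.isClosed.preimage (continuous_const_smul e)).inter
        (isClosed_biInter fun q _ => (hZ q).isClosed.preimage (continuous_proj q))
    -- `W` is a closed subset of the image of the compact set `K × ∏ Z q`; coordinates outside `F`
    -- are irrelevant and get filled with `0`.
    let s : Q × (∀ q, component Q q) → Q := fun z => z.1 + ∑ q ∈ F, (z.2 q : Q)
    have hs : Continuous s := by fun_prop
    refine ((hK.prod (isCompact_univ_pi hZ)).image hs).of_isClosed_subset hcl fun x hx => ?_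
    classical
    refine ⟨(e • x, fun q => if q ∈ F then proj Q q x else 0), ⟨hx.1, fun q _ => ?_⟩, ?_⟩
    · change (if q ∈ F then proj Q q x else 0) ∈ Z q
      split_ifs with hq
      exacts [hx.2 q hq, zero_mem _]
    · have : ∑ q ∈ F, ((if q ∈ F then proj Q q x else 0 : component Q q) : Q) =
          ∑ q ∈ F, (proj Q q x : Q) := Finset.sum_congr rfl fun q hq => by rw [if_pos hq]
      change e • x + _ = x
      rw [this, sum_proj, ← add_smul, he, ← indicator_union disjoint_compl_left,
        Set.compl_union_self, indicator_univ, one_smul]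
  · refine W.isOpen_of_mem_nhds (g := 0) ?_
    rw [hW]
    refine inter_mem ?_ ((biInter_finset_mem F).mpr fun q _ => ?_)
    · exact (continuous_const_smul e).continuousAt.preimage_mem_nhds (by simpa using hK0)
    · exact (continuous_proj q).continuousAt.preimage_mem_nhds
        ((hZo q).mem_nhds (by simp))
  · intro S x hx
    refine ⟨?_, fun q hq => ?_⟩
    · rw [smul_comm]
      exact hKs _ (indicator_mem S) _ hx.1
    · by_cases hS : q ∈ S
      · rw [proj_indicator_smul_of_mem hS]
        exact hx.2 q hq
      · rw [proj_indicator_smul_of_notMem hS]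
        exact zero_mem _

end

end FiniteAdeles

/-! ### Reconstruction of the module from its components -/

namespace FiniteAdeles

variable {P : Set Nat.Primes} {Q : Type*} [AddCommGroup Q] [Module (FiniteAdeles P) Q]

/-- The trace of a subgroup on the `q`-component. -/
def trace (W : AddSubgroup Q) (q : P) : AddSubgroup (component Q q) :=
  W.addSubgroupOf (component Q q)

theorem mem_trace {W : AddSubgroup Q} {q : P} {v : component Q q} :
    v ∈ trace W q ↔ (v : Q) ∈ W := Iff.rfl

variable [TopologicalSpace Q]

theorem mem_of_forall_proj_mem [ContinuousSMul (FiniteAdeles P) Q] [IsTopologicalAddGroup Q]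
    {W : AddSubgroup Q} (hW : IsClosed (W : Set Q)) {x : Q}
    (h : ∀ q : P, (proj Q q x : Q) ∈ W) : x ∈ W := by
  refine hW.mem_of_tendsto (tendsto_indicator_smul (P := P) x) (.of_forall fun F => ?_)
  rw [← sum_proj]
  exact sum_mem fun q _ => h q

theorem isOpen_trace {W : AddSubgroup Q} (hW : IsOpen (W : Set Q)) (q : P) :
    IsOpen (trace W q : Set (component Q q)) :=
  hW.preimage continuous_subtype_val

theorem isCompact_trace [ContinuousSMul (FiniteAdeles P) Q] [T2Space Q]
    {W : AddSubgroup Q} (hW : IsCompact (W : Set Q)) (q : P) :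
    IsCompact (trace W q : Set (component Q q)) :=
  (isClosed_component q).isClosedEmbedding_subtypeVal.isCompact_preimage hW

theorem eq_zero_of_forall_proj_eq_zero [ContinuousSMul (FiniteAdeles P) Q]
    [IsTopologicalAddGroup Q] [T2Space Q] {x : Q} (h : ∀ q : P, proj Q q x = 0) :
    x = 0 := by
  have : x ∈ (⊥ : AddSubgroup Q) :=
    mem_of_forall_proj_mem (P := P) (by simp) fun q => by simp [h q]
  simpa using this

variable [ContinuousSMul (FiniteAdeles P) Q]

variable (P) in
/-- The components of a vector, as a point of the restricted product. -/
noncomputable def components {W : AddSubgroup Q} (hW : IsOpen (W : Set Q)) :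
    Q →+ Πʳ q : P, [component Q q, trace W q] where
  toFun x := ⟨fun q => proj Q q x, by
    have h : Tendsto (fun q : P => indicator {q} • x) cofinite (𝓝 0) := by
      simpa using (tendsto_indicator_singleton (P := P)).smul_const x
    exact h.eventually (hW.mem_nhds W.zero_mem)⟩
  map_zero' := by
    ext1 q
    exact map_zero (proj Q q)
  map_add' x y := by
    ext1 q
    exact map_add (proj Q q) x y

theorem components_apply {W : AddSubgroup Q} (hW : IsOpen (W : Set Q)) (x : Q) (q : P) :
    components P hW x q = proj Q q x := rfl

variable [IsTopologicalAddGroup Q]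

theorem injective_components [T2Space Q] {W : AddSubgroup Q} (hW : IsOpen (W : Set Q)) :
    Function.Injective (components P hW) := by
  rw [injective_iff_map_eq_zero]
  intro x hx
  exact eq_zero_of_forall_proj_eq_zero (P := P) fun q => congrArg (· q) hx

theorem surjective_components [T2Space Q] {W : AddSubgroup Q} (hW : IsOpen (W : Set Q))
    (hc : IsCompact (W : Set Q)) : Function.Surjective (components P hW) := by
  classical
  intro v
  have hfin : {q | ¬ v q ∈ trace W q}.Finite := v.2
  set B := hfin.toFinset
  let s : Finset P → Q := fun F => ∑ q ∈ F, (v q : Q)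
  -- Beyond the finite bad set `B`, every new summand lies in `W`.
  have hs : ∀ᶠ F in atTop, s F ∈ (s B + ·) '' (W : Set Q) := by
    filter_upwards [eventually_ge_atTop B] with F hF
    refine ⟨∑ q ∈ F \ B, (v q : Q), sum_mem fun q hq => ?_, ?_⟩
    · have := (Finset.mem_sdiff.mp hq).2
      simpa [B, mem_trace] using this
    · exact (add_comm _ _).trans (Finset.sum_sdiff hF)
  obtain ⟨x, -, hx⟩ := (hc.image (continuous_const_add (s B))).exists_mapClusterPt_of_frequently
    hs.frequently
  refine ⟨x, ?_⟩
  ext1 q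
  rw [components_apply]
  have hq := hx.continuousAt_comp (continuous_proj (P := P) q).continuousAt
  have hlim : Tendsto (proj Q q ∘ s) atTop (𝓝 (v q)) := by
    refine tendsto_const_nhds.congr' ?_
    filter_upwards [eventually_ge_atTop {q}] with F hF
    have hF' := Finset.singleton_subset_iff.mp hF
    change v q = proj Q q (∑ r ∈ F, (v r : Q))
    rw [map_sum, Finset.sum_eq_single_of_mem q hF' fun r _ hr => proj_coe_of_ne hr.symm _,
      proj_coe]
  -- The `q`-component of the partial sums is eventually constant, so the cluster point has
  -- component `v q`.
  exact eq_of_nhds_neBot (hq.clusterPt.mono hlim)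

theorem isIsomorphicToRestrictedProduct_trace [T2Space Q] {W : AddSubgroup Q}
    (hW : IsOpen (W : Set Q)) (hc : IsCompact (W : Set Q))
    (hWs : ∀ S : Set P, ∀ x ∈ W, indicator S • x ∈ W) :
    IsIsomorphicToRestrictedProduct (P := P) Q (fun q => component Q q) (trace W) := by
  have : Fact (∀ q : P, IsOpen (trace W q : Set (component Q q))) := ⟨isOpen_trace hW⟩
  let R : W → ∀ q : P, (trace W q : Set (component Q q)) := fun x q =>
    ⟨proj Q q x, hWs {q} x x.2⟩
  have hRc : Continuous R := continuous_pi fun q =>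
    ((continuous_proj q).comp continuous_subtype_val).subtype_mk _
  have hR : Function.Bijective R := by
    constructor
    · intro x y h
      refine Subtype.ext (injective_components (P := P) hW ?_)
      ext1 q
      exact congrArg Subtype.val (congrFun h q)
    · intro v
      obtain ⟨x, hx⟩ := surjective_components hW hc (RestrictedProduct.structureMap _ _ _ v)
      have hx' (q : P) : proj Q q x = v q := congrArg (· q) hx
      refine ⟨⟨x, mem_of_forall_proj_mem (P := P) hc.isClosed fun q => ?_⟩, ?_⟩
      · rw [hx' q]
        exact (v q).2
      · ext1 q
        exact Subtype.ext (hx' q)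
  have : CompactSpace W := isCompact_iff_compactSpace.mp hc
  -- A continuous bijection from a compact space to a Hausdorff one is a homeomorphism.
  let H : W ≃ₜ ∀ q : P, (trace W q : Set (component Q q)) :=
    hRc.homeoOfEquivCompactToT2 (f := Equiv.ofBijective R hR)
  let Φ := AddEquiv.ofBijective (components P hW)
    ⟨injective_components hW, surjective_components hW hc⟩
  have hΦ : Φ ∘ ((↑) : W → Q) = RestrictedProduct.structureMap _ _ cofinite ∘ H := rfl
  have hΦ' : Φ.symm ∘ RestrictedProduct.structureMap _ _ cofinite = ((↑) : W → Q) ∘ H.symm := by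
    ext v
    obtain ⟨x, rfl⟩ := H.surjective v
    simp only [Function.comp_apply, H.symm_apply_apply]
    rw [AddEquiv.symm_apply_eq]
    exact (congrFun hΦ x).symm
  -- Both `W` and the product of traces are open, so `H` settles continuity at `0` in both
  -- directions, which suffices for homomorphisms.
  have hsm := RestrictedProduct.isOpenEmbedding_structureMap (isOpen_trace (P := P) hW)
  have hcont : Continuous Φ := by
    refine continuous_of_continuousAt_zero Φ ?_
    have h0 := (hsm.continuous.comp H.continuous).continuousAt (x := 0)
    rw [← hΦ] at h0
    exact (hW.isOpenEmbedding_subtypeVal.continuousAt_iff (x := (0 : W))).mp h0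
  have hcont' : Continuous Φ.symm := by
    refine continuous_of_continuousAt_zero Φ.symm ?_
    have h0 := (continuous_subtype_val.comp H.symm.continuous).continuousAt (x := H 0)
    rw [← hΦ'] at h0
    have h1 := (hsm.continuousAt_iff (x := H 0)).mp h0
    have h2 : RestrictedProduct.structureMap _ _ cofinite (H 0) = 0 :=
      (congrFun hΦ 0).symm.trans (map_zero Φ)
    rwa [h2] at h1
  exact ⟨{ Φ with continuous_toFun := hcont, continuous_invFun := hcont' },
    fun a x q => proj_smul q a x⟩

end FiniteAdeles

/-! ### Assembly -/

theorem mainTheorem7 (P : Set Nat.Primes) (Q : Type u) [AddCommGroup Q] [TopologicalSpace Q]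
    [IsTopologicalAddGroup Q] [T2Space Q] [LocallyCompactSpace Q]
    [Module (FiniteAdeles P) Q] [ContinuousSMul (FiniteAdeles P) Q] :
    ∃ (V : P → Type u) (_ : ∀ q, AddCommGroup (V q)) (_ : ∀ q, TopologicalSpace (V q))
      (_ : ∀ q : P, Module ℚ_[(q : Nat.Primes)] (V q)) (n : P → ℕ),
      (∀ q : P, IsTopologicalAddGroup (V q) ∧ T2Space (V q) ∧ LocallyCompactSpace (V q) ∧
        ContinuousSMul ℚ_[(q : Nat.Primes)] (V q)) ∧
      (∀ q : P, Nonempty (V q ≃L[ℚ_[(q : Nat.Primes)]] (Fin (n q) → ℚ_[(q : Nat.Primes)]))) ∧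
      (∀ q, ∃ Z : AddSubgroup (V q), IsCompact (Z : Set (V q)) ∧ IsOpen (Z : Set (V q))) ∧
      (∀ Z : ∀ q, AddSubgroup (V q),
        (∀ q, IsCompact (Z q : Set (V q)) ∧ IsOpen (Z q : Set (V q))) →
          IsIsomorphicToRestrictedProduct (P := P) Q V Z) ∧
      IsIsomorphicToRestrictedProduct (P := P) Q
        (fun q : P => Fin (n q) → ℚ_[(q : Nat.Primes)])
        (fun q : P => padicLattice (q : Nat.Primes) (n q)) := by

  choose n hn using FiniteAdeles.exists_component_equiv (P := P) (Q := Q)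
  let g (q : P) := (hn q).some
  choose Z₀ hZ₀ hZ₀' using fun q => exists_isCompact_isOpen_addSubgroup (g q)
  obtain ⟨W, hWc, hWo, hWs⟩ := FiniteAdeles.exists_addSubgroup_indicator_smul_mem Z₀ hZ₀ hZ₀'
  have hiso : IsIsomorphicToRestrictedProduct (P := P) Q
      (fun q : P => Fin (n q) → ℚ_[(q : Nat.Primes)])
      (fun q : P => padicLattice (q : Nat.Primes) (n q)) := by
    choose h hh using fun q => exists_equiv_pi_mem_padicLattice_iff (g q)
      (FiniteAdeles.trace W q) (FiniteAdeles.isCompact_trace hWc q)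
      (FiniteAdeles.isOpen_trace hWo q)
    exact (FiniteAdeles.isIsomorphicToRestrictedProduct_trace hWo hWc hWs).congr h hh
  refine ⟨fun q => FiniteAdeles.component Q q, inferInstance, inferInstance, inferInstance, n,
    fun q => ⟨inferInstance, inferInstance, inferInstance, inferInstance⟩, hn,
    fun q => ⟨Z₀ q, hZ₀ q, hZ₀' q⟩, fun Z hZ => ?_, hiso⟩
  choose h hh using fun q => exists_equiv_pi_mem_padicLattice_iff (g q) (Z q) (hZ q).1 (hZ q).2
  -- An arbitrary family `Z` is reached from the standard lattices, factor by factor.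
  refine hiso.congr (fun q => (h q).symm) fun q v => ?_
  rw [← hh, ContinuousLinearEquiv.apply_symm_apply]
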